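/- For finite simple graphs $G, F, H$ write $G \to (F,H)$ if every colouring of the edges of $G$ with two colours, red and blue, yields a red copy of $F$ or a blue copy of $H$ (as a not necessarily induced subgraph). The size-Ramsey number of the pair $(F,H)$ is $\hat R(F,H) = \min\{|E(G)| : G \to (F,H)\}$. Let $C_n$ be the cycle on $n$ vertices and $P_n$ the path on $n$ vertices. Then for all even and sufficiently large $n$, $$\hat R(C_n, P_n) \le 2257\,n.$$ -/

import Mathlib

/-- The arrow relation `G → (F, H)`: every colouring of the edges of `G` with two colours
(`true` is red, `false` is blue) has a red copy of `F` or a blue copy of `H`.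
Copies are not required to be induced. -/
def RamseyArrow {V U W : Type*} (G : SimpleGraph V) (F : SimpleGraph U) (H : SimpleGraph W) :
    Prop :=
  ∀ c : G.EdgeLabeling Bool,
    F.IsContained (c.labelGraph true) ∨ H.IsContained (c.labelGraph false)

/-- The size-Ramsey number of the pair `(F, H)`: the smallest number of edges of a finite graph `G`
with `G → (F, H)`. Finite graphs are represented on the vertex sets `Fin N`. The value lies in
`ℕ∞`, so that it is `⊤` if there is no such graph, and is an attained minimum otherwise. -/
noncomputable def sizeRamsey {U W : Type*} (F : SimpleGraph U) (H : SimpleGraph W) : ℕ∞ :=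
  sInf {m : ℕ∞ | ∃ (N : ℕ) (G : SimpleGraph (Fin N)), RamseyArrow G F H ∧ m = G.edgeSet.encard}

/-! A sparse graph on `7n` vertices, found by counting, joins any two disjoint sets of `k = ⌊n/8⌋`
vertices by an edge. It already arrows the pair.

Suppose there is no blue path on `n` vertices. Stop a depth-first search in blue when `3n` vertices
are finished: its path has fewer than `n` vertices, so at least `3n` vertices are unvisited, and no
blue edge joins them to the finished ones. Hence the red graph between these two sets has no hole of
size `k` (`ramseyArrow_cycleGraph_pathGraph`).

Such a bipartite graph contains the even cycle (`SimpleGraph.NoHole.cycleGraph_isContained`).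
Reserve part of each side and delete a few vertices so that small sets expand into the reservoirs.
Outside them, depth-first search again gives a long path. Cut it to the right length and let both
ends branch through the reservoirs, doubling the number of possible ends at each step. Once each
side has at least `k` possible ends, some pair of them is adjacent and closes a cycle of exactly `n`
vertices. -/

open Finset

/-! ### Paths and cycles given by lists -/

/-- A duplicate-free list of `n` successively adjacent vertices is a copy of `pathGraph n`. -/
theorem pathGraph_isContained_of_list {V : Type*} {G : SimpleGraph V} {l : List V} {n : ℕ}
    (hc : l.IsChain G.Adj) (hd : l.Nodup) (hn : n ≤ l.length) :
    (SimpleGraph.pathGraph n).IsContained G := by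
  refine ⟨⟨⟨fun i => l[i.1]'(by omega), ?_⟩, ?_⟩⟩
  · intro a b hab
    have key := List.isChain_iff_getElem.mp hc
    rw [SimpleGraph.pathGraph_adj] at hab
    rcases hab with h | h
    · have := key a.1 (by omega)
      simpa [h] using this
    · have := key b.1 (by omega)
      simpa [h] using this.symm
  · intro a b hab
    exact Fin.ext ((List.Nodup.getElem_inj_iff hd).mp hab)

/-- A duplicate-free list of successively adjacent vertices whose ends are adjacent is a copy of a
cycle graph. -/
theorem cycleGraph_isContained_of_list {V : Type*} {G : SimpleGraph V} {l : List V} {x y : V}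
    (hc : l.IsChain G.Adj) (hd : l.Nodup) (hx : x ∈ l.head?) (hy : y ∈ l.getLast?)
    (hxy : G.Adj x y) :
    (SimpleGraph.cycleGraph l.length).IsContained G := by
  have hx0 : ∀ h : 0 < l.length, l[0] = x := by
    intro h
    have := List.head?_eq_getElem? (l := l)
    rw [Option.mem_def.mp hx] at this
    exact (List.getElem_eq_iff h).mpr this.symm
  have hyl : ∀ h : l.length - 1 < l.length, l[l.length - 1] = y := by
    intro h
    have := List.getLast?_eq_getElem? (l := l)
    rw [Option.mem_def.mp hy] at this
    exact (List.getElem_eq_iff h).mpr this.symm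
  have key := List.isChain_iff_getElem.mp hc
  have step : ∀ a b : Fin l.length, (a - b).val = 1 → G.Adj l[a.1] l[b.1] := by
    intro a b h
    rcases le_or_gt b a with hba | hba
    · rw [Fin.sub_val_of_le hba] at h
      have h1 : a.1 = b.1 + 1 := by omega
      have := key b.1 (by omega)
      simpa [h1] using this.symm
    -- The difference wraps around, which forces `a` to be the first index and `b` the last.
    · rw [Fin.coe_sub_iff_lt.mpr hba] at h
      have h1 : a.1 = 0 := by omega
      have h2 : b.1 = l.length - 1 := by omega
      have e1 := hx0 (by omega)
      have e2 := hyl (by omega)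
      simp only [h1, h2, e1, e2]
      exact hxy
  refine ⟨⟨⟨fun i => l[i.1], ?_⟩, ?_⟩⟩
  · intro a b hab
    rw [SimpleGraph.cycleGraph_adj'] at hab
    rcases hab with h | h
    · exact step a b h
    · exact (step b a h).symm
  · intro a b hab
    exact Fin.ext ((List.Nodup.getElem_inj_iff hd).mp hab)

/-! ### Depth-first search, and parity of bipartite paths -/

/-- Depth-first search: the vertices of `W` split into a set of `f` finished vertices, the vertices
of a path, and unvisited vertices which are not adjacent to finished ones. -/
theorem SimpleGraph.exists_dfs {V : Type*} [DecidableEq V] (G : SimpleGraph V) (W : Finset V)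
    (f : ℕ) (hf : f ≤ #W) :
    ∃ (F : Finset V) (l : List V), F ⊆ W ∧ #F = f ∧ l.IsChain G.Adj ∧ l.Nodup ∧
      (∀ v ∈ l, v ∈ W ∧ v ∉ F) ∧ ∀ a ∈ F, ∀ b ∈ W, b ∉ F → b ∉ l → ¬ G.Adj a b := by
  induction f with
  | zero => exact ⟨∅, [], by simp⟩
  | succ f ih =>
    obtain ⟨F, l₀, hFW, hFc, hl₀⟩ := ih (by omega)
    let p : ℕ → Prop := fun r => ∃ l : List V, l.length = r ∧ l.IsChain G.Adj ∧ l.Nodup ∧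
      (∀ v ∈ l, v ∈ W ∧ v ∉ F) ∧ ∀ a ∈ F, ∀ b ∈ W, b ∉ F → b ∉ l → ¬ G.Adj a b
    have hb : ∀ r, p r → r ≤ #W := by
      rintro r ⟨l, rfl, -, hd, hm, -⟩
      rw [← List.toFinset_card_of_nodup hd]
      exact card_le_card fun v hv => (hm v (List.mem_toFinset.mp hv)).1
    classical
    have hp0 : p l₀.length := ⟨l₀, rfl, hl₀⟩
    -- A longest admissible path for the given `F`: its head has no unvisited neighbour, so the head
    -- can be moved to `F`.
    obtain ⟨l, hlen, hc, hd, hm, hE⟩ : p (Nat.findGreatest p #W) :=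
      Nat.findGreatest_spec (hb _ hp0) hp0
    have hmax : ∀ u : V, ¬ (u ∈ W ∧ u ∉ F ∧ u ∉ l ∧ ∀ y ∈ l.head?, G.Adj u y) := by
      rintro u ⟨huW, huF, hul, hadj⟩
      have hq : p (l.length + 1) := by
        refine ⟨u :: l, rfl, hc.cons hadj, List.nodup_cons.mpr ⟨hul, hd⟩, ?_, ?_⟩
        · intro v hv
          rcases List.mem_cons.mp hv with rfl | hv
          · exact ⟨huW, huF⟩
          · exact hm v hv
        · intro a ha b hb hbF hbl
          exact hE a ha b hb hbF fun h => hbl (List.mem_cons_of_mem _ h)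
      have := Nat.le_findGreatest (hb _ hq) hq
      omega
    cases l with
    | nil =>
      exfalso
      obtain ⟨u, hu, huF⟩ := exists_mem_notMem_of_card_lt_card (s := F) (t := W) (by omega)
      exact hmax u ⟨hu, huF, by simp, by simp⟩
    | cons v l =>
      obtain ⟨hvl, hd'⟩ := List.nodup_cons.mp hd
      obtain ⟨hvW, hvF⟩ := hm v (by simp)
      refine ⟨insert v F, l, insert_subset hvW hFW, by rw [card_insert_of_notMem hvF, hFc],
        hc.tail, hd', ?_, ?_⟩
      · intro u hu
        have := hm u (List.mem_cons_of_mem _ hu)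
        refine ⟨this.1, fun h => ?_⟩
        rcases mem_insert.mp h with rfl | h
        · exact hvl hu
        · exact this.2 h
      · intro a ha b hbW hbF hbl hab
        simp only [mem_insert, not_or] at hbF
        have hbl' : b ∉ v :: l := by simp [hbF.1, hbl]
        rcases mem_insert.mp ha with rfl | ha
        · exact hmax b ⟨hbW, hbF.2, hbl', by simpa using hab.symm⟩
        · exact hE a ha b hbW hbF.2 hbl' hab

/-- In a bipartite graph, a path with an even number of vertices joins the two sides. -/
theorem List.IsChain.getLast_mem_of_isBipartite {V : Type*} {G : SimpleGraph V} {l : List V}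
    (hc : l.IsChain G.Adj) {S T : Set V} (h : G.IsBipartiteWith S T) {x y : V}
    (hx : x ∈ l.head?) (hy : y ∈ l.getLast?) (hxS : x ∈ S) :
    (Odd l.length → y ∈ S) ∧ (Even l.length → y ∈ T) := by
  induction l generalizing S T x with
  | nil => simp at hx
  | cons a l ih =>
    cases l with
    | nil =>
      simp only [head?_cons, Option.mem_def, Option.some.injEq, getLast?_singleton] at hx hy
      subst hx hy
      simp [hxS]
    | cons b l =>
      simp only [head?_cons, Option.mem_def, Option.some.injEq] at hx
      subst hx
      have hab : G.Adj a b := (List.isChain_cons_cons.mp hc).1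
      have hb : b ∈ T := by
        rcases h.mem_of_adj hab with h1 | h1
        · exact h1.2
        · exact absurd h1.1 (Set.disjoint_left.mp h.disjoint hxS)
      have := ih hc.tail h.symm (x := b) (by simp) (by simpa using hy) hb
      rw [List.length_cons, Nat.odd_add_one, Nat.even_add_one, Nat.not_odd_iff_even,
        Nat.not_even_iff_odd]
      exact ⟨this.2, this.1⟩

/-! ### Sparse graphs without holes, by counting -/

/-- If there are fewer pairs of `k`-sets than needed to cover all sequences of `M` pairs by
sequences avoiding them, then some sequence of `M` pairs meets all pairs of disjoint `k`-sets. -/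
theorem exists_pairs_hitting_disjoint_sets {V : Type*} [Fintype V] [DecidableEq V] {k M : ℕ}
    (h : ((Fintype.card V).choose k) ^ 2 * ((Fintype.card V) ^ 2 - 2 * k ^ 2) ^ M <
      ((Fintype.card V) ^ 2) ^ M) :
    ∃ f : Fin M → V × V, ∀ A B : Finset V, Disjoint A B → #A = k → #B = k →
      ∃ i, f i ∈ A ×ˢ B ∪ B ×ˢ A := by
  by_contra! hcon
  let I : Finset (Finset V × Finset V) :=
    {p ∈ powersetCard k univ ×ˢ powersetCard k univ | Disjoint p.1 p.2}
  -- Union bound: were the claim false, every sequence would avoid both rectangles of some disjoint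
  -- pair.
  have hcover : (univ : Finset (Fin M → V × V)) ⊆
      I.biUnion fun p => Fintype.piFinset fun _ => (p.1 ×ˢ p.2 ∪ p.2 ×ˢ p.1)ᶜ := by
    intro f _
    obtain ⟨A, B, hd, hA, hB, hf⟩ := hcon f
    rw [mem_biUnion]
    refine ⟨(A, B), by simp [I, hd, hA, hB], ?_⟩
    rw [Fintype.mem_piFinset]
    exact fun i => mem_compl.mpr (hf i)
  have h1 := (card_le_card hcover).trans card_biUnion_le
  have h2 : ∀ p ∈ I, #(Fintype.piFinset fun _ : Fin M => (p.1 ×ˢ p.2 ∪ p.2 ×ˢ p.1)ᶜ) =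
      ((Fintype.card V) ^ 2 - 2 * k ^ 2) ^ M := by
    intro p hp
    simp only [I, mem_filter, mem_product, mem_powersetCard_univ] at hp
    have hd : Disjoint (p.1 ×ˢ p.2) (p.2 ×ˢ p.1) := disjoint_product.mpr (Or.inl hp.2)
    rw [Fintype.card_piFinset_const, card_compl, card_union_of_disjoint hd, card_product,
      card_product, hp.1.1, hp.1.2, Fintype.card_prod]
    congr 2 <;> ring
  rw [sum_congr rfl h2, sum_const, smul_eq_mul, card_univ, Fintype.card_fun, Fintype.card_prod,
    Fintype.card_fin, ← sq] at h1
  have h3 : #I ≤ ((Fintype.card V).choose k) ^ 2 := by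
    refine (card_filter_le _ _).trans ?_
    rw [card_product, card_powersetCard, card_univ, sq]
  exact absurd h (not_lt.mpr (h1.trans (Nat.mul_le_mul_right _ h3)))

/-- A graph with few edges in which any two disjoint `k`-sets are joined by an edge. -/
theorem exists_graph_without_bipartite_hole {V : Type*} [Fintype V] [DecidableEq V] {k M : ℕ}
    (h : ((Fintype.card V).choose k) ^ 2 * ((Fintype.card V) ^ 2 - 2 * k ^ 2) ^ M <
      ((Fintype.card V) ^ 2) ^ M) :
    ∃ G : SimpleGraph V, G.edgeSet.encard ≤ M ∧
      ∀ A B : Finset V, Disjoint A B → k ≤ #A → k ≤ #B → ∃ a ∈ A, ∃ b ∈ B, G.Adj a b := by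
  obtain ⟨f, hf⟩ := exists_pairs_hitting_disjoint_sets h
  refine ⟨SimpleGraph.fromEdgeSet (Set.range fun i => s((f i).1, (f i).2)), ?_, ?_⟩
  · rw [SimpleGraph.edgeSet_fromEdgeSet]
    refine (Set.encard_le_encard Set.sdiff_subset).trans ?_
    rw [← Set.image_univ]
    refine (Set.encard_image_le _ _).trans ?_
    simp
  · intro A B hd hA hB
    obtain ⟨A', hA', hAc⟩ := exists_subset_card_eq hA
    obtain ⟨B', hB', hBc⟩ := exists_subset_card_eq hB
    obtain ⟨i, hi⟩ := hf A' B' (hd.mono hA' hB') hAc hBc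
    have hne : ∀ a ∈ A', ∀ b ∈ B', a ≠ b := fun a ha b hb =>
      disjoint_iff_ne.mp hd a (hA' ha) b (hB' hb)
    rw [mem_union, mem_product, mem_product] at hi
    rcases hi with hi | hi
    · refine ⟨_, hA' hi.1, _, hB' hi.2, ?_⟩
      rw [SimpleGraph.fromEdgeSet_adj]
      exact ⟨⟨i, rfl⟩, hne _ hi.1 _ hi.2⟩
    · refine ⟨_, hA' hi.2, _, hB' hi.1, ?_⟩
      rw [SimpleGraph.fromEdgeSet_adj]
      exact ⟨⟨i, Sym2.eq_swap⟩, hne _ hi.2 _ hi.1⟩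

/-- Combines `N.choose k ≤ (eN/k)^k`, from `k^k / k! ≤ e^k`, with `1 - x ≤ e^(-x)` for `x = 2k²/N²`.
The exponentials then cancel exactly. -/
theorem choose_sq_mul_pow_lt {N k M : ℕ} (hk : 0 < k) (hN : 2 * k ≤ N)
    (h : Real.exp 1 * (N / k) < Real.exp (k * M / N ^ 2)) :
    (N.choose k) ^ 2 * (N ^ 2 - 2 * k ^ 2) ^ M < (N ^ 2) ^ M := by
  have hN0 : (0 : ℝ) < N := by exact_mod_cast (by omega : 0 < N)
  have hk0 : (0 : ℝ) < k := by exact_mod_cast hk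
  have hle : 2 * k ^ 2 ≤ N ^ 2 := by nlinarith
  have h1 : (N.choose k : ℝ) ≤ (Real.exp 1 * (N / k)) ^ k := by
    have e1 := Nat.choose_le_pow_div (α := ℝ) k N
    have e2 := Real.pow_div_factorial_le_exp (k : ℝ) hk0.le k
    have e3 : (N : ℝ) ^ k / k.factorial = (k : ℝ) ^ k / k.factorial * (N / k) ^ k := by
      rw [div_pow]; field_simp
    rw [e3] at e1
    rw [mul_pow, ← Real.exp_nat_mul, mul_one]
    exact e1.trans (mul_le_mul_of_nonneg_right e2 (by positivity))
  have h2 : (N.choose k : ℝ) < Real.exp (k * M / N ^ 2) ^ k :=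
    h1.trans_lt (pow_lt_pow_left₀ h (by positivity) hk.ne')
  have h3 : (N : ℝ) ^ 2 - 2 * k ^ 2 ≤ N ^ 2 * Real.exp (-(2 * k ^ 2 / N ^ 2)) := by
    have := Real.add_one_le_exp (-(2 * (k : ℝ) ^ 2 / N ^ 2))
    calc (N : ℝ) ^ 2 - 2 * k ^ 2 = N ^ 2 * (-(2 * (k : ℝ) ^ 2 / N ^ 2) + 1) := by
          field_simp; ring
      _ ≤ _ := by gcongr
  have h3' : (0 : ℝ) ≤ (N : ℝ) ^ 2 - 2 * k ^ 2 := by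
    rw [sub_nonneg]; exact_mod_cast hle
  have h4 : (Real.exp (k * M / N ^ 2) ^ k) ^ 2 * Real.exp (-(2 * k ^ 2 / N ^ 2)) ^ M = 1 := by
    rw [← Real.exp_nat_mul, ← Real.exp_nat_mul, ← Real.exp_nat_mul, ← Real.exp_add,
      Real.exp_eq_one_iff]
    push_cast
    ring
  have : ((N.choose k) ^ 2 * (N ^ 2 - 2 * k ^ 2) ^ M : ℝ) < ((N : ℝ) ^ 2) ^ M := by
    calc ((N.choose k) ^ 2 * (N ^ 2 - 2 * k ^ 2) ^ M : ℝ)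
        ≤ (N.choose k) ^ 2 * (N ^ 2 * Real.exp (-(2 * k ^ 2 / N ^ 2))) ^ M := by gcongr
      _ < (Real.exp (k * M / N ^ 2) ^ k) ^ 2 *
            (N ^ 2 * Real.exp (-(2 * k ^ 2 / N ^ 2))) ^ M := by gcongr
      _ = ((N : ℝ) ^ 2) ^ M * ((Real.exp (k * M / N ^ 2) ^ k) ^ 2 *
            Real.exp (-(2 * k ^ 2 / N ^ 2)) ^ M) := by rw [mul_pow]; ring
      _ = _ := by rw [h4, mul_one]
  have hcast : ((N ^ 2 - 2 * k ^ 2 : ℕ) : ℝ) = (N : ℝ) ^ 2 - 2 * k ^ 2 := by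
    rw [Nat.cast_sub hle]; push_cast; ring
  rw [← Nat.cast_lt (α := ℝ)]
  push_cast
  rw [hcast]
  exact this

/-! ### Expansion in bipartite graphs without holes -/

/-- The vertices of `Y` with a neighbour in `X`. -/
noncomputable def SimpleGraph.neighborsIn {V : Type*} (G : SimpleGraph V) (X Y : Finset V) :
    Finset V := by
  classical exact {b ∈ Y | ∃ a ∈ X, G.Adj a b}

theorem SimpleGraph.mem_neighborsIn {V : Type*} {G : SimpleGraph V} {X Y : Finset V} {b : V} :
    b ∈ G.neighborsIn X Y ↔ b ∈ Y ∧ ∃ a ∈ X, G.Adj a b := by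
  simp [neighborsIn]

/-- Any two subsets of `S` and `T` with at least `k` elements are joined by an edge. -/
def SimpleGraph.NoHole {V : Type*} (G : SimpleGraph V) (k : ℕ) (S T : Finset V) : Prop :=
  ∀ A ⊆ S, ∀ B ⊆ T, k ≤ #A → k ≤ #B → ∃ a ∈ A, ∃ b ∈ B, G.Adj a b

theorem SimpleGraph.NoHole.symm {V : Type*} {G : SimpleGraph V} {k : ℕ} {S T : Finset V}
    (h : G.NoHole k S T) : G.NoHole k T S := by
  intro A hA B hB hAk hBk
  obtain ⟨b, hb, a, ha, hab⟩ := h B hB A hA hBk hAk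
  exact ⟨a, ha, b, hb, hab.symm⟩

/-- `k` vertices of one side have all but fewer than `k` vertices of the other side as
neighbours. -/
theorem SimpleGraph.NoHole.card_lt {V : Type*} [DecidableEq V] {G : SimpleGraph V} {k : ℕ}
    {S T : Finset V} (h : G.NoHole k S T) {A U D : Finset V} (hA : A ⊆ S) (hAk : k ≤ #A)
    (hU : U ⊆ T) : #U < #(G.neighborsIn A (U \ D)) + #D + k := by
  by_contra! hcon
  have h1 : #U ≤ #((U \ D) \ G.neighborsIn A (U \ D)) + #D + #(G.neighborsIn A (U \ D)) := by
    have e1 := card_le_card_sdiff_add_card (s := U) (t := D)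
    have e2 := card_le_card_sdiff_add_card (s := U \ D) (t := G.neighborsIn A (U \ D))
    omega
  obtain ⟨a, ha, b, hb, hab⟩ := h A hA ((U \ D) \ G.neighborsIn A (U \ D))
    (sdiff_subset.trans (sdiff_subset.trans hU)) hAk (by omega)
  rw [mem_sdiff] at hb
  exact hb.2 (mem_neighborsIn.mpr ⟨hb.1, a, ha, hab⟩)

/-- After the removal of fewer than `k` vertices on each side, all sets with fewer than `k` vertices
expand by a factor of four into the reservoirs `U₁` and `U₂`. -/
theorem SimpleGraph.NoHole.exists_expanding {V : Type*} [DecidableEq V] {G : SimpleGraph V} {k : ℕ}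
    {S T U₁ U₂ : Finset V} (h : G.NoHole k S T) (hU₁ : U₁ ⊆ S) (hU₂ : U₂ ⊆ T)
    (hc₁ : 11 * k ≤ #U₁) (hc₂ : 11 * k ≤ #U₂) :
    ∃ D₁ D₂ : Finset V, #D₁ ≤ k ∧ #D₂ ≤ k ∧
      (∀ X ⊆ S \ D₁, #X < k → 4 * #X ≤ #(G.neighborsIn X (U₂ \ D₂))) ∧
      (∀ X ⊆ T \ D₂, #X < k → 4 * #X ≤ #(G.neighborsIn X (U₁ \ D₁))) := by
  classical
  -- Pairs of poorly expanding sets. In a maximal pair both sets have at most `k` elements, so a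
  -- further bad set of fewer than `k` elements could be added within the bound `2k`, against
  -- maximality.
  let I : Finset (Finset V × Finset V) := {p ∈ S.powerset ×ˢ T.powerset |
    #p.1 ≤ 2 * k ∧ #p.2 ≤ 2 * k ∧ #(G.neighborsIn p.1 (U₂ \ p.2)) ≤ 4 * #p.1 ∧
      #(G.neighborsIn p.2 (U₁ \ p.1)) ≤ 4 * #p.2}
  have hI : ∀ p, p ∈ I ↔ (p.1 ⊆ S ∧ p.2 ⊆ T) ∧ #p.1 ≤ 2 * k ∧ #p.2 ≤ 2 * k ∧
      #(G.neighborsIn p.1 (U₂ \ p.2)) ≤ 4 * #p.1 ∧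
      #(G.neighborsIn p.2 (U₁ \ p.1)) ≤ 4 * #p.2 := by
    intro p
    simp only [I, mem_filter, mem_product, mem_powerset]
  have hne : (∅, ∅) ∈ I := by
    rw [hI]
    simp [neighborsIn]
  obtain ⟨⟨D₁, D₂⟩, hD, hmax⟩ := I.exists_max_image (fun p => #p.1 + #p.2) ⟨_, hne⟩
  obtain ⟨⟨hS, hT⟩, hb₁, hb₂, hn₁, hn₂⟩ := (hI _).mp hD
  dsimp only at hS hT hb₁ hb₂ hn₁ hn₂ hmax
  have hk₁ : #D₁ ≤ k := by
    by_contra! hcon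
    -- Here `11k` is used: `#U₂ < 4·2k + 2k + k`.
    have := h.card_lt (D := D₂) hS hcon.le hU₂
    omega
  have hk₂ : #D₂ ≤ k := by
    by_contra! hcon
    have := h.symm.card_lt (D := D₁) hT hcon.le hU₁
    omega
  have hunion : ∀ D X U E : Finset V, #(G.neighborsIn (D ∪ X) (U \ E)) ≤
      #(G.neighborsIn D (U \ E)) + #(G.neighborsIn X (U \ E)) := by
    intro D X U E
    refine (card_le_card ?_).trans (card_union_le _ _)
    intro b hb
    obtain ⟨hbU, a, ha, hab⟩ := mem_neighborsIn.mp hb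
    rw [mem_union, mem_neighborsIn, mem_neighborsIn]
    exact (mem_union.mp ha).imp (fun ha => ⟨hbU, a, ha, hab⟩) (fun ha => ⟨hbU, a, ha, hab⟩)
  have hmono : ∀ D U E X : Finset V, #(G.neighborsIn D (U \ (E ∪ X))) ≤
      #(G.neighborsIn D (U \ E)) := by
    intro D U E X
    refine card_le_card fun b hb => ?_
    rw [mem_neighborsIn] at hb ⊢
    exact ⟨sdiff_subset_sdiff subset_rfl subset_union_left hb.1, hb.2⟩
  refine ⟨D₁, D₂, hk₁, hk₂, ?_, ?_⟩
  · intro X hX hXk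
    by_contra! hcon
    have hd : Disjoint D₁ X := disjoint_of_subset_right hX disjoint_sdiff
    have hcard := card_union_of_disjoint hd
    have := hmax (D₁ ∪ X, D₂) <| by
      rw [hI]
      refine ⟨⟨union_subset hS (hX.trans sdiff_subset), hT⟩, ?_, hb₂, ?_, ?_⟩
      · dsimp only; omega
      · have := hunion D₁ X U₂ D₂
        dsimp only; omega
      · exact (hmono _ _ _ _).trans hn₂
    dsimp only at this
    omega
  · intro X hX hXk
    by_contra! hcon
    have hd : Disjoint D₂ X := disjoint_of_subset_right hX disjoint_sdiff
    have hcard := card_union_of_disjoint hd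
    have := hmax (D₁, D₂ ∪ X) <| by
      rw [hI]
      refine ⟨⟨hS, union_subset hT (hX.trans sdiff_subset)⟩, hb₁, ?_, ?_, ?_⟩
      · dsimp only; omega
      · exact (hmono _ _ _ _).trans hn₁
      · have := hunion D₂ X U₁ D₁
        dsimp only; omega
    dsimp only at this
    omega

/-! ### Growing paths and closing cycles -/

/-- A path in a set disjoint from expanding reservoirs extends, within the reservoirs, to paths
between all pairs of elements of two sets with `2 ^ j` elements. -/
theorem SimpleGraph.exists_extensions {V : Type*} [DecidableEq V] {G : SimpleGraph V} {k : ℕ}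
    {S T U₁ U₂ : Finset V} (hST : Disjoint S T) (hU₁ : U₁ ⊆ S) (hU₂ : U₂ ⊆ T)
    (he₁ : ∀ X ⊆ S, #X < k → 4 * #X ≤ #(G.neighborsIn X U₂))
    (he₂ : ∀ X ⊆ T, #X < k → 4 * #X ≤ #(G.neighborsIn X U₁))
    {P : List V} (hP : P.IsChain G.Adj) (hPd : P.Nodup) (hPU₁ : ∀ v ∈ P, v ∉ U₁)
    (hPU₂ : ∀ v ∈ P, v ∉ U₂) {v w : V} (hv : v ∈ P.head?) (hw : w ∈ P.getLast?) (hvS : v ∈ S)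
    (hwT : w ∈ T) (j : ℕ) (hj : ∀ i < j, 2 ^ i < k) :
    ∃ A ⊆ S, ∃ B ⊆ T, #A = 2 ^ j ∧ #B = 2 ^ j ∧ ∃ W₁ ⊆ U₁, ∃ W₂ ⊆ U₂,
      #W₁ ≤ 2 * 2 ^ j ∧ #W₂ ≤ 2 * 2 ^ j ∧ ∀ x ∈ A, ∀ y ∈ B, ∃ l : List V,
        l.IsChain G.Adj ∧ l.Nodup ∧ x ∈ l.head? ∧ y ∈ l.getLast? ∧
        l.length = P.length + 2 * j ∧ ∀ z ∈ l, z ∈ P ∨ z ∈ W₁ ∨ z ∈ W₂ := by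
  induction j with
  | zero =>
    refine ⟨{v}, by simpa, {w}, by simpa, by simp, by simp, ∅, by simp, ∅, by simp, by simp,
      by simp, ?_⟩
    intro x hx y hy
    rw [mem_singleton] at hx hy
    subst hx hy
    exact ⟨P, hP, hPd, hv, hw, by simp, fun z hz => Or.inl hz⟩
  | succ j ih =>
    obtain ⟨A, hA, B, hB, hAc, hBc, W₁, hW₁, W₂, hW₂, hc₁, hc₂, hl⟩ :=
      ih fun i hi => hj i (by omega)
    have hjk := hj j (by omega)
    have h2 : 2 ^ (j + 1) = 2 * 2 ^ j := by ring
    have hNA := he₁ A hA (by omega)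
    have hNB := he₂ B hB (by omega)
    -- Of at least `4·2^j` neighbours at most `2·2^j` are used already; this is why expansion by
    -- four suffices for doubling.
    have hsub₁ : 2 ^ (j + 1) ≤ #(G.neighborsIn B U₁ \ W₁) := by
      have := card_le_card_sdiff_add_card (s := G.neighborsIn B U₁) (t := W₁)
      omega
    have hsub₂ : 2 ^ (j + 1) ≤ #(G.neighborsIn A U₂ \ W₂) := by
      have := card_le_card_sdiff_add_card (s := G.neighborsIn A U₂) (t := W₂)
      omega
    obtain ⟨A', hA', hAc'⟩ := exists_subset_card_eq hsub₁
    obtain ⟨B', hB', hBc'⟩ := exists_subset_card_eq hsub₂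
    have hA'' : ∀ x ∈ A', x ∈ U₁ ∧ x ∉ W₁ ∧ ∃ y ∈ B, G.Adj y x := by
      intro x hx
      have := mem_sdiff.mp (hA' hx)
      have h1 := mem_neighborsIn.mp this.1
      exact ⟨h1.1, this.2, h1.2⟩
    have hB'' : ∀ x ∈ B', x ∈ U₂ ∧ x ∉ W₂ ∧ ∃ y ∈ A, G.Adj y x := by
      intro x hx
      have := mem_sdiff.mp (hB' hx)
      have h1 := mem_neighborsIn.mp this.1
      exact ⟨h1.1, this.2, h1.2⟩
    have hdU : ∀ x ∈ U₁, x ∉ U₂ := fun x h1 h2 => Finset.disjoint_left.mp hST (hU₁ h1) (hU₂ h2)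
    refine ⟨A', fun x hx => hU₁ (hA'' x hx).1, B', fun x hx => hU₂ (hB'' x hx).1, hAc', hBc',
      W₁ ∪ A', union_subset hW₁ fun x hx => (hA'' x hx).1,
      W₂ ∪ B', union_subset hW₂ fun x hx => (hB'' x hx).1, ?_, ?_, ?_⟩
    · have := card_union_le W₁ A'
      omega
    · have := card_union_le W₂ B'
      omega
    · intro x' hx' y' hy'
      obtain ⟨hxU, hxW, y, hy, hyx⟩ := hA'' x' hx'
      obtain ⟨hyU, hyW, x, hx, hxy⟩ := hB'' y' hy'
      obtain ⟨l, hlc, hld, hlx, hly, hlen, hlm⟩ := hl x hx y hy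
      have hxl : x' ∉ l := by
        intro h
        rcases hlm x' h with h | h | h
        · exact hPU₁ _ h hxU
        · exact hxW h
        · exact hdU _ hxU (hW₂ h)
      have hyl : y' ∉ l := by
        intro h
        rcases hlm y' h with h | h | h
        · exact hPU₂ _ h hyU
        · exact hdU _ (hW₁ h) hyU
        · exact hyW h
      have hne : x' ≠ y' := fun h => hdU _ hxU (h ▸ hyU)
      have hlr : l.reverse.IsChain G.Adj := by
        rw [List.isChain_reverse]
        exact hlc.imp fun _ _ h => h.symm
      have hlne : l ≠ [] := by
        rintro rfl
        simp at hlx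
      -- Each new end lies on the side opposite to the old end it is attached to; reversing keeps
      -- the head in `S`.
      refine ⟨x' :: (l.reverse ++ [y']), ?_, ?_, by simp,
        by rw [← List.cons_append]; exact List.getLast?_concat .., ?_, ?_⟩
      · refine (hlr.append (List.isChain_singleton _) ?_).cons ?_
        · intro a ha b hb
          rw [List.getLast?_reverse, hlx, Option.mem_some_iff] at ha
          simp only [List.head?_cons, Option.mem_some_iff] at hb
          rw [← ha, ← hb]
          exact hxy
        · intro a ha
          rw [List.head?_append_of_ne_nil _ (by simpa using hlne), List.head?_reverse, hly,
            Option.mem_some_iff] at ha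
          rw [← ha]
          exact hyx.symm
      · rw [List.nodup_cons, List.nodup_append]
        refine ⟨by simp [hxl, hne], List.nodup_reverse.mpr hld, by simp, ?_⟩
        intro a ha b hb hab
        rw [List.mem_singleton] at hb
        rw [List.mem_reverse] at ha
        exact hyl (hb ▸ hab ▸ ha)
      · simp [hlen]
        ring
      · intro z hz
        simp only [List.mem_cons, List.mem_append, List.mem_reverse, List.not_mem_nil,
          or_false] at hz
        simp only [mem_union]
        rcases hz with rfl | hz | rfl
        · exact Or.inr (Or.inl (Or.inr hx'))
        · rcases hlm z hz with h | h | h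
          · exact Or.inl h
          · exact Or.inr (Or.inl (Or.inl h))
          · exact Or.inr (Or.inr (Or.inl h))
        · exact Or.inr (Or.inr (Or.inr hy'))

/-- In a bipartite graph without holes, two large sets on the two sides span a long path. -/
theorem SimpleGraph.NoHole.exists_path {V : Type*} [DecidableEq V] {G : SimpleGraph V} {k : ℕ}
    {S T : Finset V} (h : G.NoHole k S T) (hd : Disjoint S T) {n : ℕ}
    (hS : n + 2 * k ≤ #S) (hT : n + 2 * k ≤ #T) :
    ∃ l : List V, n ≤ l.length ∧ l.IsChain G.Adj ∧ l.Nodup ∧ ∀ v ∈ l, v ∈ S ∨ v ∈ T := by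
  obtain ⟨F, l, hF, hFc, hc, hnd, hm, hE⟩ := G.exists_dfs (S ∪ T) (2 * k)
    (by rw [card_union_of_disjoint hd]; omega)
  refine ⟨l, ?_, hc, hnd, fun v hv => mem_union.mp (hm v hv).1⟩
  by_contra! hlen
  have hl : #l.toFinset ≤ l.length := List.toFinset_card_le l
  have hsplit : #F ≤ #(F ∩ S) + #(F ∩ T) := by
    calc #F = #(F ∩ S ∪ F ∩ T) := by rw [← inter_union_distrib_left, inter_eq_left.mpr hF]
      _ ≤ _ := card_union_le _ _
  -- If `k` of the `2k` finished vertices lie in `S'`, at most `k` lie in `T'`. A path with fewer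
  -- than `n` vertices then leaves `k` unvisited ones in `T'`, and an edge to them contradicts the
  -- search.
  have main : ∀ S' T' : Finset V, S' ∪ T' = S ∪ T → Disjoint S' T' → G.NoHole k S' T' →
      n + 2 * k ≤ #T' → k ≤ #(F ∩ S') → False := by
    intro S' T' hu hd' hh hc' hFS
    obtain ⟨A, hA, hAc⟩ := exists_subset_card_eq hFS
    have h1 := card_le_card_sdiff_add_card (s := T') (t := F)
    have h2 := card_le_card_sdiff_add_card (s := T' \ F) (t := l.toFinset)
    obtain ⟨a, ha, b, hb, hab⟩ := hh A (hA.trans inter_subset_right) ((T' \ F) \ l.toFinset)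
      (sdiff_subset.trans sdiff_subset) hAc.ge (by
        have h3 : #(T' \ F) + #(F ∩ T') = #T' := by
          rw [inter_comm]; exact card_sdiff_add_card_inter T' F
        have h4 : #(F ∩ S') + #(F ∩ T') ≤ #F := by
          rw [← card_union_of_disjoint (hd'.mono inter_subset_right inter_subset_right)]
          exact card_le_card (union_subset inter_subset_left inter_subset_left)
        omega)
    simp only [mem_sdiff, List.mem_toFinset] at hb
    exact hE a (mem_inter.mp (hA ha)).1 b (hu ▸ mem_union_right _ hb.1.1) hb.1.2 hb.2 hab
  rcases Nat.lt_or_ge #(F ∩ S) k with hlt | hge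
  · exact main T S (union_comm _ _) hd.symm h.symm hS (by omega)
  · exact main S T rfl hd h hT hge

/-- A bipartite graph without holes contains all sufficiently long even cycles which are shorter
than its sides by a fixed multiple of the size of holes. -/
theorem SimpleGraph.NoHole.cycleGraph_isContained {V : Type*} [DecidableEq V] {G : SimpleGraph V}
    {k : ℕ} {S T : Finset V} (h : G.NoHole k S T) (hG : G.IsBipartiteWith S T) {n : ℕ}
    (hS : n + 14 * k ≤ #S) (hT : n + 14 * k ≤ #T) (hn : Even n)
    (hkn : 2 * Nat.clog 2 k + 2 ≤ n) : (cycleGraph n).IsContained G := by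
  have hST : Disjoint S T := disjoint_coe.mp hG.disjoint
  obtain ⟨U₁, hU₁, hc₁⟩ := exists_subset_card_eq (s := S) (n := 11 * k) (by omega)
  obtain ⟨U₂, hU₂, hc₂⟩ := exists_subset_card_eq (s := T) (n := 11 * k) (by omega)
  obtain ⟨D₁, D₂, hD₁, hD₂, he₁, he₂⟩ := h.exists_expanding hU₁ hU₂ hc₁.ge hc₂.ge
  have hsub₁ : (S \ D₁) \ U₁ ⊆ S := sdiff_subset.trans sdiff_subset
  have hsub₂ : (T \ D₂) \ U₂ ⊆ T := sdiff_subset.trans sdiff_subset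
  have hh' : G.NoHole k ((S \ D₁) \ U₁) ((T \ D₂) \ U₂) := fun A hA B hB =>
    h A (hA.trans hsub₁) B (hB.trans hsub₂)
  -- The `14k` is spent as `11k` for the reservoir, `k` for the deleted set and `2k` for the path
  -- search.
  obtain ⟨l, hlen, hlc, hld, hlm⟩ := hh'.exists_path (hST.mono hsub₁ hsub₂) (n := n)
    (by
      have e1 := card_le_card_sdiff_add_card (s := S) (t := D₁)
      have e2 := card_le_card_sdiff_add_card (s := S \ D₁) (t := U₁)
      omega)
    (by
      have e1 := card_le_card_sdiff_add_card (s := T) (t := D₂)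
      have e2 := card_le_card_sdiff_add_card (s := T \ D₂) (t := U₂)
      omega)
  set j := Nat.clog 2 k with hj
  obtain ⟨P, v, w, hPlen, hPc, hPd, hPm, hv, hw, hvS, hwT⟩ : ∃ (P : List V) (v w : V),
      P.length = n - 2 * j ∧ P.IsChain G.Adj ∧ P.Nodup ∧
      (∀ v ∈ P, v ∈ (S \ D₁) \ U₁ ∨ v ∈ (T \ D₂) \ U₂) ∧ v ∈ P.head? ∧ w ∈ P.getLast? ∧
      v ∈ S \ D₁ ∧ w ∈ T \ D₂ := by
    -- The `j` extensions add two vertices each. The truncated length stays even, so the ends lie on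
    -- opposite sides.
    obtain ⟨P, hPl, hPlen⟩ : ∃ P, P = l.take (n - 2 * j) ∧ P.length = n - 2 * j :=
      ⟨_, rfl, by rw [List.length_take]; omega⟩
    have hPc : P.IsChain G.Adj := hPl ▸ hlc.take _
    have hPd : P.Nodup := hPl ▸ hld.sublist (List.take_sublist _ _)
    have hPm : ∀ v ∈ P, v ∈ (S \ D₁) \ U₁ ∨ v ∈ (T \ D₂) \ U₂ := fun v hv =>
      hlm v (List.mem_of_mem_take (hPl ▸ hv))
    have hPne : P ≠ [] := by
      rintro rfl
      simp only [List.length_nil] at hPlen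
      omega
    have hv : P.head hPne ∈ P.head? := List.head_mem_head? hPne
    have hw : P.getLast hPne ∈ P.getLast? := List.getLast_mem_getLast? hPne
    have heven : Even P.length := by
      rw [hPlen, Nat.even_sub (by omega)]
      simp [hn]
    have hvm := hPm _ (List.head_mem hPne)
    have hwm := hPm _ (List.getLast_mem hPne)
    rcases hvm with hvm | hvm
    · have := (hPc.getLast_mem_of_isBipartite hG hv hw (hsub₁ hvm)).2 heven
      have hwm' := hwm.resolve_left fun h' =>
        Finset.disjoint_left.mp hST (hsub₁ h') this
      exact ⟨P, _, _, hPlen, hPc, hPd, hPm, hv, hw, sdiff_subset hvm, sdiff_subset hwm'⟩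
    · have := (hPc.getLast_mem_of_isBipartite hG.symm hv hw (hsub₂ hvm)).2 heven
      have hwm' := hwm.resolve_right fun h' =>
        Finset.disjoint_left.mp hST this (hsub₂ h')
      refine ⟨P.reverse, _, _, by simpa using hPlen, ?_, List.nodup_reverse.mpr hPd,
        fun v hv => hPm v (List.mem_reverse.mp hv), by rwa [List.head?_reverse],
        by rwa [List.getLast?_reverse], sdiff_subset hwm', sdiff_subset hvm⟩
      rw [List.isChain_reverse]
      exact hPc.imp fun _ _ h => h.symm
  have hd₁ : ∀ v ∈ P, v ∉ U₁ \ D₁ := by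
    intro v hvP hvU
    rcases hPm v hvP with h1 | h1
    · exact (mem_sdiff.mp h1).2 (mem_sdiff.mp hvU).1
    · exact Finset.disjoint_left.mp hST (hU₁ (mem_sdiff.mp hvU).1) (hsub₂ h1)
  have hd₂ : ∀ v ∈ P, v ∉ U₂ \ D₂ := by
    intro v hvP hvU
    rcases hPm v hvP with h1 | h1
    · exact Finset.disjoint_left.mp hST (hsub₁ h1) (hU₂ (mem_sdiff.mp hvU).1)
    · exact (mem_sdiff.mp h1).2 (mem_sdiff.mp hvU).1
  obtain ⟨A, hA, B, hB, hAc, hBc, W₁, -, W₂, -, -, -, hl⟩ := G.exists_extensions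
    (hST.mono sdiff_subset sdiff_subset) (sdiff_subset_sdiff hU₁ subset_rfl)
    (sdiff_subset_sdiff hU₂ subset_rfl) he₁ he₂ hPc hPd hd₁ hd₂ hv hw hvS hwT j
    (fun i hi => Nat.pow_lt_of_lt_clog hi)
  have hkj : k ≤ 2 ^ j := Nat.le_pow_clog (by norm_num) k
  obtain ⟨x, hx, y, hy, hxy⟩ := h A (hA.trans sdiff_subset) B (hB.trans sdiff_subset)
    (by omega) (by omega)
  obtain ⟨L, hLc, hLd, hLx, hLy, hLlen, -⟩ := hl x hx y hy
  have hLn : L.length = n := by omega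
  exact hLn ▸ cycleGraph_isContained_of_list hLc hLd hLx hLy hxy

/-! ### The arrow relation and the numerical constants -/

/-- If the `N ≥ 7n` vertices of `G` are such that disjoint sets of size `k ≤ n / 8` are joined by
edges, then `G` arrows an even cycle and a path on `n` vertices. -/
theorem ramseyArrow_cycleGraph_pathGraph {V : Type*} [Fintype V] {G : SimpleGraph V} {k n : ℕ}
    (hG : ∀ A B : Finset V, Disjoint A B → k ≤ #A → k ≤ #B → ∃ a ∈ A, ∃ b ∈ B, G.Adj a b)
    (hkn : 8 * k ≤ n) (hn : Even n) (hV : 7 * n ≤ Fintype.card V) :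
    RamseyArrow G (SimpleGraph.cycleGraph n) (SimpleGraph.pathGraph n) := by
  classical
  intro c
  rw [or_iff_not_imp_right]
  intro hblue
  obtain ⟨S, l, -, hS, hc, hd, hm, hE⟩ := (c.labelGraph false).exists_dfs univ (3 * n)
    (by rw [card_univ]; omega)
  have hl : l.length < n := by
    by_contra! hlen
    exact hblue (pathGraph_isContained_of_list hc hd hlen)
  let T : Finset V := (univ \ S) \ l.toFinset
  have hST : Disjoint S T := disjoint_of_subset_right sdiff_subset disjoint_sdiff
  have hT : 3 * n ≤ #T := by
    have e1 := card_le_card_sdiff_add_card (s := univ) (t := S)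
    have e2 := card_le_card_sdiff_add_card (s := univ \ S) (t := l.toFinset)
    have e3 := List.toFinset_card_le l
    rw [card_univ] at e1
    change 3 * n ≤ #((univ \ S) \ l.toFinset)
    omega
  have hred : ((c.labelGraph true).between S T).NoHole k S T := by
    intro A hA B hB hAk hBk
    obtain ⟨a, ha, b, hb, hab⟩ := hG A B (hST.mono hA hB) hAk hBk
    refine ⟨a, ha, b, hb, ?_⟩
    rw [SimpleGraph.between_adj]
    refine ⟨?_, Or.inl ⟨hA ha, hB hb⟩⟩
    have hbT := hB hb
    simp only [T, mem_sdiff, mem_univ, true_and, List.mem_toFinset] at hbT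
    have hnot := hE a (hA ha) b (mem_univ _) hbT.1 hbT.2
    rw [SimpleGraph.EdgeLabeling.labelGraph_adj] at hnot ⊢
    push Not at hnot
    exact ⟨hab, by simpa using hnot hab⟩
  have hclog : Nat.clog 2 k ≤ k := Nat.clog_le_of_le_pow Nat.lt_two_pow_self.le
  have hcyc := hred.cycleGraph_isContained (n := n)
    (SimpleGraph.between_isBipartiteWith (disjoint_coe.mpr hST)) (by omega) (by omega) hn
    (by
      -- For `k = 0` the hypothesis `hG` fails on empty sets; otherwise `2k + 2 ≤ 8k ≤ n`.
      rcases Nat.eq_zero_or_pos k with rfl | hk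
      · obtain ⟨a, ha, -⟩ := hG ∅ ∅ (by simp) (by simp) (by simp)
        simp at ha
      · omega)
  exact hcyc.trans (SimpleGraph.IsContained.of_le SimpleGraph.between_le)

/-- With `N = 7n` and `M = 2257n`, `N/k` is at most `57 < e^(9/2)`, while `kM/N² = 2257k/(49n)` is
at least `11/2`. The bound `70 ≤ k` absorbs the rounding in `k = ⌊n/8⌋`. -/
theorem exp_one_mul_lt_exp {k n : ℕ} (hk : 70 ≤ k) (h₁ : 8 * k ≤ n) (h₂ : n ≤ 8 * k + 7) :
    Real.exp 1 * ((7 * n : ℕ) / k) < Real.exp (k * (2257 * n : ℕ) / (7 * n : ℕ) ^ 2) := by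
  have hk0 : (70 : ℝ) ≤ k := by exact_mod_cast hk
  have h₁' : (8 * k : ℝ) ≤ n := by exact_mod_cast h₁
  have h₂' : (n : ℝ) ≤ 8 * k + 7 := by exact_mod_cast h₂
  have hn0 : (0 : ℝ) < n := by linarith
  have e1 : ((7 * n : ℕ) / k : ℝ) ≤ 57 := by
    push_cast
    rw [div_le_iff₀ (by linarith)]
    linarith
  have e2 : (11 / 2 : ℝ) ≤ k * (2257 * n : ℕ) / (7 * n : ℕ) ^ 2 := by
    push_cast
    rw [le_div_iff₀ (by positivity)]
    nlinarith
  have e3 : (57 : ℝ) < Real.exp (9 / 2) := by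
    have h9 : Real.exp (9 / 2) ^ 2 = Real.exp 1 ^ 9 := by
      rw [← Real.exp_nat_mul, ← Real.exp_nat_mul]
      norm_num
    have h10 : (2.7 : ℝ) ^ 9 ≤ Real.exp 1 ^ 9 := by
      have := Real.exp_one_gt_d9
      gcongr
      linarith
    refine lt_of_pow_lt_pow_left₀ 2 (Real.exp_pos _).le ?_
    rw [h9]
    refine lt_of_lt_of_le ?_ h10
    norm_num
  calc Real.exp 1 * ((7 * n : ℕ) / k) ≤ Real.exp 1 * 57 := by gcongr
    _ < Real.exp 1 * Real.exp (9 / 2) := by gcongr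
    _ = Real.exp (11 / 2) := by rw [← Real.exp_add]; norm_num
    _ ≤ _ := Real.exp_le_exp.mpr e2

theorem theorem6p1 :
    ∃ n₀ : ℕ, ∀ n : ℕ, n₀ ≤ n → Even n →
      sizeRamsey (SimpleGraph.cycleGraph n) (SimpleGraph.pathGraph n) ≤ ((2257 * n : ℕ) : ℕ∞) := by
  -- `560 = 8·70` ensures `n / 8 ≥ 70`.
  refine ⟨560, fun n hn heven => ?_⟩
  have hk : 70 ≤ n / 8 := by omega
  obtain ⟨G, hcard, hG⟩ := exists_graph_without_bipartite_hole (V := Fin (7 * n)) (k := n / 8)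
    (M := 2257 * n) (by
      rw [Fintype.card_fin]
      exact choose_sq_mul_pow_lt (by omega) (by omega)
        (exp_one_mul_lt_exp hk (by omega) (by omega)))
  have harrow : RamseyArrow G (SimpleGraph.cycleGraph n) (SimpleGraph.pathGraph n) :=
    ramseyArrow_cycleGraph_pathGraph hG (by omega) heven (by simp)
  have hle : sizeRamsey (SimpleGraph.cycleGraph n) (SimpleGraph.pathGraph n) ≤
      G.edgeSet.encard := sInf_le ⟨7 * n, G, harrow, rfl⟩
  exact hle.trans hcard
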